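/- Let $X$ be a smooth complex projective variety with a semiorthogonal decomposition $D^b(X)=\langle \mathcal T,\mathcal N\rangle$ (so $\mathrm{Hom}(\mathcal N,\mathcal T)=0$), where $\mathcal N=\langle E_0,\dots,E_n\rangle$ is generated by an exceptional collection $\mathcal E$ of sheaves. Let $\preceq$ be a grading of $\mathcal E$, i.e. a total preorder such that $E_i\preceq E_j$ for $i<j$ and such that $E_i\preceq E_j\preceq E_i$ implies that $E_i,E_j$ are equal or orthogonal; assume that $(\mathcal E,\preceq)$ is sharp, i.e. $\preceq$ has a unique maximal element (which is then $E_n$). The equivalence classes (blocks) are ordered as $b_k\prec\cdots\prec b_0=\{E_n\}$; let $\nu(E)=j$ for $E\in b_j$, put $S_i=E_i[\nu(E_i)]$, and let $\mathcal C$ be the extension closure of $S_0,\dots,S_n$ in $\mathcal N$. Fix finitely generated abelian groups $\Lambda_{\mathcal T},\Lambda_{\mathcal N}$ and a homomorphism $v:K_0(D^b(X))\to\Lambda_{\mathcal T}\oplus\Lambda_{\mathcal N}$ which restricts to homomorphisms $K_0(\mathcal T)\to\Lambda_{\mathcal T}$ and $K_0(\mathcal N)\to\Lambda_{\mathcal N}$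 that are surjective after tensoring with $\mathbf Q$; the support property of stability conditions is understood with respect to these. A stability condition is written as a pair (central charge, heart); for a nonzero object $E$ of the heart, $\phi(E)=\tfrac1\pi\arg Z(E)\in(0,1]$. Let $\tau=(V,\mathcal B)$ be a stability condition on $\mathcal T$ and $\eta=(W,\mathcal C)$ one on $\mathcal N$ (with the heart $\mathcal C$ above). For $F\in D^b(X)$ let $N^F\to F\to T^F\to N^F[1]$ be the distinguished triangle with $N^F\in\mathcal N$, $T^F\in\mathcal T$. Assume: (i) $\eta$ is spiked at $E_n$ with respect to $[N^F]\in K_0(\mathcal N)$: $\Re W(S_i)>0$ and $\Im W(S_i)>0$ for $i=0,\dots,n$, and $\Re W(S_n)-\frac{\Re W(w)}{\Im W(w)}\Im W(N^F)-1>0$ for every $0\neq w\in\sum_{i=0}^{n-1}\mathbf R_{\ge0}[S_i]\subset K_0(\mathcal N)_{\mathbf R}$; (ii) $V(T^F)=-1$; (iii) there is a stability condition $\sigma=(Z,\mathcal A)$ on $D^b(X)$ glued from $\tau$ and $\eta$: $\mathrm{Hom}(\mathcal B,\mathcal C[l])=0$ for all $l\le0$, $\mathcal A$ consists of the objects $G$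 with $T^G\in\mathcal B$ and $N^G\in\mathcal C$, and $Z=V\oplus W$; (iv) $F\in\mathcal A$ and $\mathrm{pr}_{E_n}(F)=1$, i.e. the coefficient of $[E_n]$ in $[N^F]\in K_0(\mathcal N)=\bigoplus_i\mathbf Z[E_i]$ is $1$. Suppose moreover that $N^F$ is efficient, i.e. $\mathrm{Hom}(E_i[\nu(E_i)],N^F)=0$ whenever $\nu(E_i)\ne0$, that $T^F$ is stable of phase one in $\mathcal B$, and that, with $\phi^{+}(b_j)$ and $\phi^-(b_j)$ the maximum and minimum of $\phi(S_i)$ over $E_i\in b_j$, $$\phi(E_n)<\phi(N^F)<\phi^-(b_1)\le\phi^+(b_1)<\cdots<\phi^-(b_k)\le\phi^+(b_k)<1 .$$ Then $F$ is $\sigma$-stable or $F\cong N^F\oplus T^F$. -/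

import Mathlib

open CategoryTheory Limits Pretriangulated Triangulated AlgebraicGeometry
open scoped TensorProduct

universe w

/-! ## Smooth complex projective varieties and their bounded derived categories -/

section Geometry

attribute [local instance] MvPolynomial.gradedAlgebra

/-- Projective `n`-space over `ℂ`: the scheme `Proj ℂ[x₀, …, xₙ]`. -/
noncomputable def complexProjectiveSpace (n : ℕ) : Scheme.{0} :=
  Proj (MvPolynomial.homogeneousSubmodule (Fin (n + 1)) ℂ)

/-- The structure morphism of projective `n`-space over `ℂ`. -/
noncomputable def complexProjectiveSpaceToSpec (n : ℕ) :
    complexProjectiveSpace n ⟶ Spec (CommRingCat.of ℂ) :=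
  Proj.toSpecZero (MvPolynomial.homogeneousSubmodule (Fin (n + 1)) ℂ) ≫
    Spec.map (CommRingCat.ofHom
      (algebraMap ℂ (MvPolynomial.homogeneousSubmodule (Fin (n + 1)) ℂ 0)))

end Geometry

/-- A smooth complex projective variety: an integral scheme, smooth over `ℂ`, which admits a closed
immersion over `ℂ` into some projective space. -/
structure SmoothProjectiveVariety where
  toScheme : Scheme.{0}
  structureMap : toScheme ⟶ Spec (CommRingCat.of ℂ)
  isIntegral : IsIntegral toScheme
  smooth : Smooth structureMap
  projective : ∃ (n : ℕ) (i : toScheme ⟶ complexProjectiveSpace n),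
    IsClosedImmersion i ∧ i ≫ complexProjectiveSpaceToSpec n = structureMap

namespace SmoothProjectiveVariety

/-- The abelian category of sheaves of `𝒪_X`-modules. -/
abbrev Mod (X : SmoothProjectiveVariety) : Type 1 := X.toScheme.Modules

/-- The constants `ℂ → Γ(U, 𝒪_X)`. -/
noncomputable def scalars (X : SmoothProjectiveVariety) (U : X.toScheme.Opens) :
    ℂ →+* Γ(X.toScheme, U) :=
  ((Scheme.ΓSpecIso (CommRingCat.of ℂ)).inv ≫ X.structureMap.appTop ≫
    X.toScheme.presheaf.map (homOfLE le_top).op).hom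

lemma map_scalars (X : SmoothProjectiveVariety) {U V : X.toScheme.Opens} (i : U ⟶ V) (c : ℂ) :
    (X.toScheme.presheaf.map i.op).hom (X.scalars V c) = X.scalars U c := by
  have h : X.toScheme.presheaf.map (homOfLE (le_top : V ≤ ⊤)).op ≫ X.toScheme.presheaf.map i.op
      = X.toScheme.presheaf.map (homOfLE (le_top : U ≤ ⊤)).op := by
    rw [← Functor.map_comp]
    rfl
  simp only [scalars, ← h]
  rfl

/-- Multiplication by a complex number on a sheaf of `𝒪_X`-modules. -/
noncomputable def mulScalar (X : SmoothProjectiveVariety) (c : ℂ) (M : X.Mod) : M ⟶ M :=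
  SheafOfModules.Hom.mk
    (PresheafOfModules.homMk (M₁ := M.val) (M₂ := M.val)
      { app := fun U => AddCommGrpCat.ofHom
          (DistribSMul.toAddMonoidHom Γ(M, U.unop) (X.scalars U.unop c))
        naturality := fun U V i => by
          ext m
          have h := M.map_smul i.unop (X.scalars U.unop c) m
          rw [show (ConcreteCategory.hom (X.toScheme.presheaf.map i.unop.op)) (X.scalars U.unop c)
            = X.scalars V.unop c from X.map_scalars i.unop c] at h
          exact h.symm }
      (fun U r m => by
        let m' : Γ(M, U.unop) := m
        let r' : Γ(X.toScheme, U.unop) := r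
        exact smul_comm (X.scalars U.unop c) r' m'))

lemma mulScalar_app (X : SmoothProjectiveVariety) (c : ℂ) (M : X.Mod) (U : X.toScheme.Opens)
    (m : Γ(M, U)) : (X.mulScalar c M).app U m = X.scalars U c • m := rfl

/-- Scalars act on the identity functor of the category of sheaves of modules. -/
noncomputable def toCenter (X : SmoothProjectiveVariety) : ℂ →+* CatCenter X.Mod where
  toFun c :=
    { app := fun M => X.mulScalar c M
      naturality := fun M N f => by
        ext U m
        exact (Scheme.Modules.Hom.app_smul f (X.scalars U c) m).symm }
  map_one' := by
    ext M U m
    change (X.mulScalar 1 M).app U m = m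
    rw [mulScalar_app, map_one, one_smul]
  map_mul' a b := by
    ext M U m
    change (X.mulScalar (a * b) M).app U m = (X.mulScalar a M).app U ((X.mulScalar b M).app U m)
    simp only [mulScalar_app, map_mul, mul_smul]
  map_zero' := by
    ext M U m
    change (X.mulScalar 0 M).app U m = 0
    rw [mulScalar_app, map_zero, zero_smul]
  map_add' a b := by
    ext M U m
    change (X.mulScalar (a + b) M).app U m =
      (X.mulScalar a M).app U m + (X.mulScalar b M).app U m
    simp only [mulScalar_app, map_add, add_smul]

/-- The `ℂ`-linear structure on the category of sheaves of `𝒪_X`-modules. -/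
noncomputable instance (X : SmoothProjectiveVariety) : Linear ℂ X.Mod :=
  Linear.ofRingMorphism X.toCenter

/-- Coherent sheaves on `X`. Since `X` is Noetherian, these are the sheaves of modules that are
locally cokernels of morphisms between finite free modules. -/
def IsCoherent (X : SmoothProjectiveVariety) : ObjectProperty X.Mod :=
  fun M => SheafOfModules.IsFinitePresentation (R := X.toScheme.ringCatSheaf) M

lemma isCoherent_free (X : SmoothProjectiveVariety) (σ : Type) [Finite σ] :
    X.IsCoherent (SheafOfModules.free (R := X.toScheme.ringCatSheaf) σ) := by
  obtain ⟨P, h₁, h₂⟩ : ∃ P : (SheafOfModules.free (R := X.toScheme.ringCatSheaf) σ).Presentation,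
      Finite P.generators.I ∧ Finite P.relations.I :=
    ⟨SheafOfModules.presentationOfIsCokernelFree
      (0 : SheafOfModules.free (R := X.toScheme.ringCatSheaf) PEmpty ⟶ SheafOfModules.free σ)
      (𝟙 _) (by simp) (CokernelCofork.IsColimit.ofId _ rfl),
      (inferInstance : Finite σ), (inferInstance : Finite PEmpty.{1})⟩
  exact ⟨P.quasicoherentData, ⟨fun i => ⟨⟨h₁⟩, ⟨h₂⟩⟩⟩⟩

variable (X : SmoothProjectiveVariety) [HasDerivedCategory.{w} X.Mod]

/-- Coherent sheaves, seen as complexes concentrated in degree zero in the derived category of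
sheaves of `𝒪_X`-modules. -/
def coherentInDegreeZero : ObjectProperty (DerivedCategory X.Mod) :=
  fun K => ∃ M : X.Mod, X.IsCoherent M ∧ Nonempty (K ≅ (DerivedCategory.singleFunctor X.Mod 0).obj M)

/-- The complexes in `D^b(X)`, as a thick triangulated subcategory of the derived category of
sheaves of `𝒪_X`-modules: the smallest one that contains the coherent sheaves. Coherent sheaves
are closed under kernels, cokernels, extensions and direct summands, so it consists exactly of the
complexes with bounded coherent cohomology. -/
def isBoundedCoherent : ObjectProperty (DerivedCategory X.Mod) :=
  X.coherentInDegreeZero.triangEnvelope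

instance : X.isBoundedCoherent.IsTriangulated := by
  have : X.coherentInDegreeZero.Nonempty :=
    ⟨_, _, X.isCoherent_free PEmpty, ⟨Iso.refl _⟩⟩
  unfold isBoundedCoherent
  infer_instance

instance : X.isBoundedCoherent.IsClosedUnderIsomorphisms := by
  unfold isBoundedCoherent
  infer_instance

/-- The bounded derived category `D^b(X)` of coherent sheaves on `X`. -/
abbrev Db : Type _ := X.isBoundedCoherent.FullSubcategory

/-- The objects of `D^b(X)` that are (isomorphic to) coherent sheaves in degree zero. -/
def IsSheaf : ObjectProperty X.Db :=
  fun K => X.coherentInDegreeZero K.obj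

end SmoothProjectiveVariety

/-! ## Triangulated categories: Grothendieck group, hearts and stability conditions -/

section Triangulated

universe v u

variable {C : Type u} [Category.{v} C] [Preadditive C] [HasZeroObject C] [HasShift C ℤ]
  [∀ n : ℤ, (shiftFunctor C n).Additive] [Pretriangulated C]

variable (C) in
/-- The relations `[B] = [A] + [C]` of the Grothendieck group, one for each distinguished triangle
`A ⟶ B ⟶ C ⟶ A⟦1⟧`. -/
def K0Relations : AddSubgroup (FreeAbelianGroup C) :=
  AddSubgroup.closure {x | ∃ S ∈ distTriang C,
    x = FreeAbelianGroup.of S.obj₂ - FreeAbelianGroup.of S.obj₁ - FreeAbelianGroup.of S.obj₃}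

variable (C) in
/-- The Grothendieck group of a triangulated category. -/
abbrev K0 : Type u := FreeAbelianGroup C ⧸ K0Relations C

/-- The class of an object in the Grothendieck group. -/
def K0.mk (A : C) : K0 C := QuotientAddGroup.mk (FreeAbelianGroup.of A)

/-- The extension closure of a class of objects: the smallest class which contains it and the zero
objects, and which contains the middle term of a distinguished triangle as soon as it contains the
outer ones. (It is closed under isomorphisms: consider the triangles `A ⟶ B ⟶ 0 ⟶ A⟦1⟧`.) -/
inductive ExtensionClosure (P : ObjectProperty C) : C → Prop
  | of (A : C) : P A → ExtensionClosure P A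
  | zero (A : C) : IsZero A → ExtensionClosure P A
  | ext (S : Triangle C) : S ∈ distTriang C → ExtensionClosure P S.obj₁ →
      ExtensionClosure P S.obj₃ → ExtensionClosure P S.obj₂

/-- The phase `(1/π) arg Z(A)` of an object. For `Z(A)` in the upper half plane or on the negative
real axis, it lies in `(0, 1]`. -/
noncomputable def phase (Z : K0 C →+ ℂ) (A : C) : ℝ := (Z (K0.mk A)).arg / Real.pi

/-- Semistability of an object `A` of a heart with respect to a stability function: every nonzero
subobject `Y` in the heart has phase at most that of `A`. Short exact sequences in the heart are
distinguished triangles whose three vertices lie in the heart. -/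
def IsSemistableInHeart (heart : ObjectProperty C) (Z : K0 C →+ ℂ) (A : C) : Prop :=
  heart A ∧ ¬ IsZero A ∧
    ∀ ⦃Y Q : C⦄ (f : Y ⟶ A) (g : A ⟶ Q) (h : Q ⟶ Y⟦(1 : ℤ)⟧), Triangle.mk f g h ∈ distTriang C →
      heart Y → heart Q → ¬ IsZero Y → phase Z Y ≤ phase Z A

/-- Stability of an object `A` of a heart with respect to a stability function: every nonzero
proper subobject `Y` in the heart has phase smaller than that of `A`. -/
def IsStableInHeart (heart : ObjectProperty C) (Z : K0 C →+ ℂ) (A : C) : Prop :=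
  heart A ∧ ¬ IsZero A ∧
    ∀ ⦃Y Q : C⦄ (f : Y ⟶ A) (g : A ⟶ Q) (h : Q ⟶ Y⟦(1 : ℤ)⟧), Triangle.mk f g h ∈ distTriang C →
      heart Y → heart Q → ¬ IsZero Y → ¬ IsZero Q → phase Z Y < phase Z A

/-- A Harder-Narasimhan filtration `0 = A₀ ⊆ A₁ ⊆ ⋯ ⊆ Aₘ = A` in a heart: the successive quotients
are semistable of strictly decreasing phases. -/
def HasHNFiltration (heart : ObjectProperty C) (Z : K0 C →+ ℂ) (A : C) : Prop :=
  ∃ (m : ℕ) (F : Fin (m + 1) → C) (Q : Fin m → C) (f : ∀ i, F i.castSucc ⟶ F i.succ)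
    (g : ∀ i, F i.succ ⟶ Q i) (h : ∀ i, Q i ⟶ (F i.castSucc)⟦(1 : ℤ)⟧),
    IsZero (F 0) ∧ Nonempty (F (Fin.last m) ≅ A) ∧ (∀ i, heart (F i)) ∧
    (∀ i, Triangle.mk (f i) (g i) (h i) ∈ distTriang C) ∧
    (∀ i, IsSemistableInHeart heart Z (Q i)) ∧ StrictAnti fun i => phase Z (Q i)

/-- A (Bridgeland) stability condition with respect to a homomorphism `v : K₀(C) → Λ`: the heart of
a bounded t-structure, with a central charge which is a stability function on the heart, has the
Harder-Narasimhan property, and satisfies the support property for some (equivalently, any) norm on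
`Λ_ℝ`. -/
structure StabilityCondition {Λ : Type*} [AddCommGroup Λ] (v : K0 C →+ Λ) where
  tStructure : TStructure C
  bounded : ∀ A : C, tStructure.bounded A
  charge : K0 C →+ ℂ
  charge_mem : ∀ A : C, tStructure.heart A → ¬ IsZero A →
    0 < (charge (K0.mk A)).im ∨ ((charge (K0.mk A)).im = 0 ∧ (charge (K0.mk A)).re < 0)
  harderNarasimhan : ∀ A : C, tStructure.heart A → ¬ IsZero A →
    HasHNFiltration tStructure.heart charge A
  support : ∃ p : Seminorm ℝ (ℝ ⊗[ℤ] Λ), (∀ x, p x = 0 → x = 0) ∧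
    ∃ c : ℝ, 0 < c ∧ ∀ A : C, IsSemistableInHeart tStructure.heart charge A →
      c * p (1 ⊗ₜ v (K0.mk A)) ≤ ‖charge (K0.mk A)‖

namespace StabilityCondition

variable {Λ : Type*} [AddCommGroup Λ] {v : K0 C →+ Λ} (σ : StabilityCondition v)

/-- The heart of a stability condition. -/
def heart : ObjectProperty C := σ.tStructure.heart

/-- The phase of an object of the heart. -/
noncomputable def phase (A : C) : ℝ := _root_.phase σ.charge A

/-- The stable objects of the heart of a stability condition. -/
def IsStable (A : C) : Prop := IsStableInHeart σ.heart σ.charge A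

end StabilityCondition

/-! ### Graded exceptional collections -/

/-- A family `E₀, …, Eₙ` is an exceptional collection in a `k`-linear category: each `Eᵢ` is
exceptional and there are no morphisms of any degree from `Eⱼ` to `Eᵢ` for `i < j`. -/
structure IsExceptionalCollection (k : Type*) [Field k] [Linear k C] {n : ℕ}
    (E : Fin (n + 1) → C) : Prop where
  end_eq : ∀ i (f : E i ⟶ E i), ∃! c : k, f = c • 𝟙 (E i)
  shift_eq_zero : ∀ i (l : ℤ), l ≠ 0 → ∀ f : E i ⟶ (E i)⟦l⟧, f = 0
  semiorthogonal : ∀ i j, i < j → ∀ (l : ℤ) (f : E j ⟶ (E i)⟦l⟧), f = 0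

/-- A family of objects is full: no proper strictly full triangulated subcategory contains it. -/
def IsFullCollection {n : ℕ} (E : Fin (n + 1) → C) : Prop :=
  ∀ P : ObjectProperty C, P.IsTriangulated → P.IsClosedUnderIsomorphisms →
    (∀ i, P (E i)) → ∀ A, P A

/-- Two objects are orthogonal: there are no morphisms of any degree between them. -/
def AreOrthogonal (A B : C) : Prop :=
  ∀ l : ℤ, (∀ f : A ⟶ B⟦l⟧, f = 0) ∧ (∀ f : B ⟶ A⟦l⟧, f = 0)

/-- A grading of an exceptional collection: a total preorder `r` on its members, which extends
their given order, and such that equivalent members are equal or orthogonal. -/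
structure IsGrading {n : ℕ} (E : Fin (n + 1) → C) (r : Fin (n + 1) → Fin (n + 1) → Prop) :
    Prop where
  refl : ∀ i, r i i
  trans : ∀ i j l, r i j → r j l → r i l
  total : ∀ i j, r i j ∨ r j i
  of_lt : ∀ i j, i < j → r i j
  orthogonal : ∀ i j, r i j → r j i → i = j ∨ AreOrthogonal (E i) (E j)

/-- A preorder is sharp if it has a unique maximal element. -/
def IsSharp {n : ℕ} (r : Fin (n + 1) → Fin (n + 1) → Prop) : Prop :=
  ∃! i, ∀ j, r i j → r j i

/-- The norm function of a grading: it descends to an order-reversing bijection from the set of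
equivalence classes (blocks) to `{0, …, k}`. -/
def IsNormFunction {n : ℕ} (r : Fin (n + 1) → Fin (n + 1) → Prop) (k : ℕ)
    (ν : Fin (n + 1) → ℕ) : Prop :=
  Set.range ν = Set.Iic k ∧ ∀ i j, r i j ↔ ν j ≤ ν i

/-- The objects `Sᵢ = Eᵢ⟦ν(Eᵢ)⟧`. -/
noncomputable def shiftedCollection {n : ℕ} (E : Fin (n + 1) → C) (ν : Fin (n + 1) → ℕ) :
    Fin (n + 1) → C :=
  fun i => (E i)⟦(ν i : ℤ)⟧

/-- Efficient objects: there are no morphisms from `Eᵢ⟦ν(Eᵢ)⟧` when `ν(Eᵢ) ≠ 0`. -/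
def IsEfficient {n : ℕ} (E : Fin (n + 1) → C) (ν : Fin (n + 1) → ℕ) (A : C) : Prop :=
  ∀ i, ν i ≠ 0 → ∀ f : shiftedCollection E ν i ⟶ A, f = 0

/-- The coefficient of `[Sₙ]` in the expansion of the class of `A` in terms of
`[S₀], …, [Sₙ]` equals `d`. (For the objects `Sᵢ = Eᵢ⟦ν(Eᵢ)⟧` of a full exceptional collection,
these classes form a basis of the Grothendieck group.) -/
def LastCoefficientEq {n : ℕ} (S : Fin (n + 1) → C) (A : C) (d : ℤ) : Prop :=
  ∃ m : Fin (n + 1) → ℤ, K0.mk A = ∑ i, m i • K0.mk (S i) ∧ m (Fin.last n) = d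

/-- The smallest phase `φ⁻(b_j)` of the objects `Sᵢ` with `ν(Eᵢ) = j`. -/
noncomputable def minBlockPhase {n : ℕ} (W : K0 C →+ ℂ) (S : Fin (n + 1) → C)
    (ν : Fin (n + 1) → ℕ) (j : ℕ) : ℝ :=
  ⨅ i : {i // ν i = j}, phase W (S i)

/-- The largest phase `φ⁺(b_j)` of the objects `Sᵢ` with `ν(Eᵢ) = j`. -/
noncomputable def maxBlockPhase {n : ℕ} (W : K0 C →+ ℂ) (S : Fin (n + 1) → C)
    (ν : Fin (n + 1) → ℕ) (j : ℕ) : ℝ :=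
  ⨆ i : {i // ν i = j}, phase W (S i)

/-- The `ℝ`-linear extension `K₀(C)_ℝ → ℂ` of a central charge. -/
noncomputable def chargeReal (W : K0 C →+ ℂ) : ℝ ⊗[ℤ] K0 C →ₗ[ℝ] ℂ :=
  TensorProduct.AlgebraTensorModule.lift
    ((LinearMap.lsmul ℝ (K0 C →ₗ[ℤ] ℂ)).flip W.toIntLinearMap)

lemma chargeReal_tmul (W : K0 C →+ ℂ) (t : ℝ) (x : K0 C) :
    chargeReal W (t ⊗ₜ[ℤ] x) = t • W x := rfl

/-- The cone of nonzero combinations of `[S₀], …, [Sₙ₋₁]` (omitting the last object) with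
nonnegative real coefficients in `K₀(C)_ℝ`. -/
def openCone {n : ℕ} (S : Fin (n + 1) → C) : Set (ℝ ⊗[ℤ] K0 C) :=
  {w | w ≠ 0 ∧ ∃ c : Fin n → ℝ, (∀ i, 0 ≤ c i) ∧
    w = ∑ i : Fin n, c i • ((1 : ℝ) ⊗ₜ[ℤ] K0.mk (S i.castSucc))}

/-- A central charge `W` is spiked at the last of the simple objects `S₀, …, Sₙ` with respect to a
class `u`. -/
structure IsSpiked {n : ℕ} (W : K0 C →+ ℂ) (S : Fin (n + 1) → C) (u : K0 C) : Prop where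
  re_pos : ∀ i, 0 < (W (K0.mk (S i))).re
  im_pos : ∀ i, 0 < (W (K0.mk (S i))).im
  spike : ∀ w ∈ openCone S,
    0 < (W (K0.mk (S (Fin.last n)))).re
      - (chargeReal W w).re / (chargeReal W w).im * (W u).im - 1

/-! ### Semiorthogonal decompositions and gluing -/

/-- A semiorthogonal decomposition `⟨T, N⟩` into two (strictly full triangulated) subcategories. -/
structure IsSemiorthogonalDecomposition (T N : ObjectProperty C) : Prop where
  hom_eq_zero : ∀ A B, N A → T B → ∀ f : A ⟶ B, f = 0
  exists_triangle : ∀ F : C, ∃ (A B : C) (f : A ⟶ F) (g : F ⟶ B) (h : B ⟶ A⟦(1 : ℤ)⟧),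
    N A ∧ T B ∧ Triangle.mk f g h ∈ distTriang C

/-- A homomorphism of abelian groups is a rational surjection. -/
def IsRationalSurjection {A B : Type*} [AddCommGroup A] [AddCommGroup B] (f : A →+ B) : Prop :=
  Function.Surjective (f.toIntLinearMap.lTensor ℚ)

/-- A stability condition `σ` is glued from stability conditions `τ` and `η` on the components of a
semiorthogonal decomposition `⟨T, N⟩`: there are no morphisms of degree `≤ 0` from the heart of
`τ` to that of `η`; the heart of `σ` consists of the objects whose projections to `T` and `N` lie in
the hearts of `τ` and `η`; and the central charge of `σ` is the direct sum of those of `τ` and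
`η`. -/
structure IsGlued {T N : ObjectProperty C} [T.IsTriangulated] [N.IsTriangulated]
    {Λ ΛT ΛN : Type*} [AddCommGroup Λ] [AddCommGroup ΛT] [AddCommGroup ΛN]
    {v : K0 C →+ Λ} {vT : K0 T.FullSubcategory →+ ΛT} {vN : K0 N.FullSubcategory →+ ΛN}
    (σ : StabilityCondition v) (τ : StabilityCondition vT) (η : StabilityCondition vN) :
    Prop where
  hom_eq_zero : ∀ (B : T.FullSubcategory) (A : N.FullSubcategory), τ.heart B → η.heart A →
    ∀ l : ℤ, l ≤ 0 → ∀ f : B.obj ⟶ A.obj⟦l⟧, f = 0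
  heart_iff : ∀ F : C, σ.heart F ↔
    ∃ (A : N.FullSubcategory) (B : T.FullSubcategory) (f : A.obj ⟶ F) (g : F ⟶ B.obj)
      (h : B.obj ⟶ A.obj⟦(1 : ℤ)⟧),
      Triangle.mk f g h ∈ distTriang C ∧ η.heart A ∧ τ.heart B
  charge_left : ∀ B : T.FullSubcategory, σ.charge (K0.mk B.obj) = τ.charge (K0.mk B)
  charge_right : ∀ A : N.FullSubcategory, σ.charge (K0.mk A.obj) = η.charge (K0.mk A)

end Triangulated

/-! ## Euler characteristics of long exact sequences -/

section LongExactSequence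

variable {k : Type*} [Field k] {A B C : ℤ → Type*}
  [∀ l, AddCommGroup (A l)] [∀ l, Module k (A l)]
  [∀ l, AddCommGroup (B l)] [∀ l, Module k (B l)]
  [∀ l, AddCommGroup (C l)] [∀ l, Module k (C l)]

/-! Write `Z(F) = W(N^F) - 1` and take a triangle `Y → F → Q` with all vertices in the glued heart.
Projecting it to both components (`exists_distinguished_projections`) gives triangles `N^Y → N^F →
N^Q` and `T^Y → T^F → T^Q` with vertices in the hearts `𝒞` and `ℬ`. Both are very restricted. A
stable object of phase one is simple (`StabilityCondition.IsStable.isZero_or_isZero`), so `T^Y` or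
`T^Q` vanishes. The coefficient at `E_n` is additive, nonnegative on `𝒞` and equal to one on `N^F`,
so it is one on exactly one of `N^Y`, `N^Q`.

If the coefficient of `N^Y` is zero, then `N^Y` is an iterated extension of objects `S_i` with `i <
n`. Efficiency kills the monomorphism `N^Y → N^F`, so `N^Y = 0`; then either `Y = 0`, or `Y ≅ T^Y ≅
T^F` splits `F`.

Otherwise `N^Q` is an extension of the `S_i` with `i < n`, and only charges have to be compared.
When `T^Y = 0`, these `S_i` have larger phase than `N^F`, so `N^Y` has at most the phase of `N^F`,
and the summand `-1` makes the phase of `F` strictly larger (`re_mul_im_le_of_phase_lt`). When `T^Q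
= 0`, the spike condition says that `W(N^Q)` has larger phase than `W(N^F) - 1`
(`IsSpiked.re_mul_im_lt`).

For the coefficient at `E_n` to be well defined on the Grothendieck group, it is realized as the
Euler pairing with `E_n` (`IsExceptionalCollection.exists_lastCoefficient`). -/

lemma Module.Finite.of_exact_of_finite {U V W : Type*} [AddCommGroup U] [Module k U]
    [AddCommGroup V] [Module k V] [AddCommGroup W] [Module k W] (f : U →ₗ[k] V) (g : V →ₗ[k] W)
    (h : Function.Exact f g) [Module.Finite k U] [Module.Finite k W] : Module.Finite k V := by
  have h₁ : Module.Finite k (LinearMap.ker g) := by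
    rw [h.linearMap_ker_eq]
    infer_instance
  have h₂ : Module.Finite k (V ⧸ LinearMap.ker g) :=
    Module.Finite.equiv g.quotKerEquivRange.symm
  exact Module.Finite.of_submodule_quotient (LinearMap.ker g)

/-- The Euler characteristic is additive on long exact sequences. -/
lemma finsum_negOnePow_finrank_of_exact (f : ∀ l, A l →ₗ[k] B l) (g : ∀ l, B l →ₗ[k] C l)
    (h : ∀ l, C l →ₗ[k] A (l + 1)) (hfg : ∀ l, Function.Exact (f l) (g l))
    (hgh : ∀ l, Function.Exact (g l) (h l)) (hhf : ∀ l, Function.Exact (h l) (f (l + 1)))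
    [∀ l, Module.Finite k (A l)] [∀ l, Module.Finite k (B l)] [∀ l, Module.Finite k (C l)]
    (hA : {l | ¬ Subsingleton (A l)}.Finite) (hC : {l | ¬ Subsingleton (C l)}.Finite) :
    ∑ᶠ l : ℤ, (l.negOnePow : ℤ) * (Module.finrank k (B l) : ℤ) =
      ∑ᶠ l : ℤ, (l.negOnePow : ℤ) * (Module.finrank k (A l) : ℤ) +
      ∑ᶠ l : ℤ, (l.negOnePow : ℤ) * (Module.finrank k (C l) : ℤ) := by
  -- Each dimension is the sum of the ranks of the incoming and the outgoing map. The rank `t` of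
  -- the connecting map enters `A` with its index shifted by one, hence with the opposite sign, and
  -- cancels against its contribution to `C`.
  let r (l : ℤ) : ℤ := Module.finrank k (LinearMap.range (f l))
  let s (l : ℤ) : ℤ := Module.finrank k (LinearMap.range (g l))
  let t (l : ℤ) : ℤ := Module.finrank k (LinearMap.range (h l))
  have ha (l : ℤ) : (Module.finrank k (A l) : ℤ) = t (l - 1) + r l := by
    obtain ⟨l, rfl⟩ : ∃ m, l = m + 1 := ⟨l - 1, by ring⟩
    have := (f (l + 1)).finrank_range_add_finrank_ker
    rw [(hhf l).linearMap_ker_eq] at this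
    simp only [r, t, ← this, add_sub_cancel_right]
    push_cast
    ring
  have hb (l : ℤ) : (Module.finrank k (B l) : ℤ) = r l + s l := by
    have := (g l).finrank_range_add_finrank_ker
    rw [(hfg l).linearMap_ker_eq] at this
    simp only [r, s, ← this]
    push_cast
    ring
  have hc (l : ℤ) : (Module.finrank k (C l) : ℤ) = s l + t l := by
    have := (h l).finrank_range_add_finrank_ker
    rw [(hgh l).linearMap_ker_eq] at this
    simp only [s, t, ← this]
    push_cast
    ring
  have hr₀ : (Function.support fun l : ℤ => (l.negOnePow : ℤ) * r l).Finite := by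
    refine hA.subset fun l hl h' => hl ?_
    have : Module.finrank k (LinearMap.range (f l)) = 0 := Module.finrank_eq_zero_iff.2 fun x =>
      ⟨1, one_ne_zero, by
        obtain ⟨_, y, rfl⟩ := x
        ext
        simp [Subsingleton.elim y 0]⟩
    simp [r, this]
  have ht₀ : (Function.support fun l : ℤ => (l.negOnePow : ℤ) * t l).Finite := by
    refine hC.subset fun l hl h' => hl ?_
    have : Module.finrank k (LinearMap.range (h l)) = 0 := Module.finrank_eq_zero_iff.2 fun x =>
      ⟨1, one_ne_zero, by
        obtain ⟨_, y, rfl⟩ := x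
        ext
        simp [Subsingleton.elim y 0]⟩
    simp [t, this]
  have hs₀ : (Function.support fun l : ℤ => (l.negOnePow : ℤ) * s l).Finite := by
    refine hC.subset fun l hl h' => hl ?_
    have h0 : (Module.finrank k (C l) : ℤ) = 0 := by
      exact_mod_cast Module.finrank_zero_of_subsingleton
    have : s l = 0 := by
      have h₁ : 0 ≤ s l := Int.natCast_nonneg _
      have h₂ : 0 ≤ t l := Int.natCast_nonneg _
      have := hc l
      omega
    simp [this]
  have shift (l : ℤ) : (l.negOnePow : ℤ) * t (l - 1) =
      -(((l - 1).negOnePow : ℤ) * t (l - 1)) := by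
    rw [Int.negOnePow_sub, Int.negOnePow_one]
    push_cast
    ring
  have ht₁ : (Function.support fun l : ℤ => (l.negOnePow : ℤ) * t (l - 1)).Finite := by
    refine (ht₀.image (· + 1)).subset fun l hl => ⟨l - 1, ?_, by simp⟩
    intro h'
    apply hl
    change (l.negOnePow : ℤ) * t (l - 1) = 0
    rw [shift]
    exact neg_eq_zero.2 h'
  have ht₂ : ∑ᶠ l : ℤ, (l.negOnePow : ℤ) * t (l - 1) =
      -∑ᶠ l : ℤ, (l.negOnePow : ℤ) * t l := by
    rw [← finsum_neg_distrib]
    simp only [shift]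
    exact finsum_comp_equiv (Equiv.subRight (1 : ℤ))
      (f := fun l : ℤ => -((l.negOnePow : ℤ) * t l))
  simp only [ha, hb, hc, mul_add]
  rw [finsum_add_distrib hr₀ hs₀, finsum_add_distrib ht₁ hr₀, finsum_add_distrib hs₀ ht₀, ht₂]
  ring

end LongExactSequence

/-! ## Euler pairing with a fixed object of a triangulated category -/

section Triangulated

set_option linter.unusedSectionVars false

open scoped ZeroObject

universe v u

variable {C : Type u} [Category.{v} C] [Preadditive C] [HasZeroObject C] [HasShift C ℤ]
  [∀ n : ℤ, (shiftFunctor C n).Additive] [Pretriangulated C]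

/-! ### Classes in the Grothendieck group -/

lemma K0.mk_eq_add {S : Triangle C} (hS : S ∈ distTriang C) :
    K0.mk S.obj₂ = K0.mk S.obj₁ + K0.mk S.obj₃ := by
  have h : FreeAbelianGroup.of S.obj₂ - FreeAbelianGroup.of S.obj₁ - FreeAbelianGroup.of S.obj₃ ∈
      K0Relations C := AddSubgroup.subset_closure ⟨S, hS, rfl⟩
  have h' := (QuotientAddGroup.eq_zero_iff _).2 h
  simp only [QuotientAddGroup.mk_sub] at h'
  rw [sub_sub, sub_eq_zero] at h'
  exact h'

/-- The triangle `A → A → A` with zero maps is isomorphic to a contractible one, so `[A] = [A] +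
[A]`. -/
lemma K0.mk_eq_zero {A : C} (hA : IsZero A) : K0.mk A = 0 := by
  have h₁ := K0.mk_eq_add (isomorphic_distinguished _ (contractible_distinguished (0 : C))
    (Triangle.mk (0 : A ⟶ A) (0 : A ⟶ A) (0 : A ⟶ A⟦(1 : ℤ)⟧))
    (Triangle.isoMk _ _ hA.isoZero hA.isoZero hA.isoZero
      (hA.eq_of_src _ _) (hA.eq_of_src _ _) (hA.eq_of_src _ _)))
  simpa using h₁

lemma K0.mk_eq_of_iso {A B : C} (e : A ≅ B) : K0.mk A = K0.mk B := by
  have h := K0.mk_eq_add (isomorphic_distinguished _ (contractible_distinguished A)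
    (Triangle.mk e.hom (0 : B ⟶ (0 : C)) 0)
    (Triangle.isoMk _ _ (Iso.refl _) e.symm (Iso.refl _)
      (by change e.hom ≫ e.inv = 𝟙 A ≫ 𝟙 A; simp) ((isZero_zero C).eq_of_tgt _ _) ((isZero_zero C).eq_of_src _ _)))
  simp only [Triangle.mk_obj₁, Triangle.mk_obj₂, Triangle.mk_obj₃,
    K0.mk_eq_zero (isZero_zero C), add_zero] at h
  exact h.symm

/-- The homomorphism on the Grothendieck group induced by an additive function on objects. -/
def K0.lift {G : Type*} [AddCommGroup G] (χ : C → G)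
    (hχ : ∀ S ∈ distTriang C, χ S.obj₂ = χ S.obj₁ + χ S.obj₃) : K0 C →+ G :=
  QuotientAddGroup.lift _ (FreeAbelianGroup.lift χ) (by
    rw [K0Relations, AddSubgroup.closure_le]
    rintro _ ⟨S, hS, rfl⟩
    simp [hχ S hS])

lemma K0.lift_mk {G : Type*} [AddCommGroup G] (χ : C → G)
    (hχ : ∀ S ∈ distTriang C, χ S.obj₂ = χ S.obj₁ + χ S.obj₃) (A : C) :
    K0.lift χ hχ (K0.mk A) = χ A :=
  FreeAbelianGroup.lift_apply_of _ _

variable (k : Type*) [Field k] [Linear k C]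

/-- The Euler characteristic of the complex of morphisms from `E` to `A`. -/
noncomputable def eulerPairing (E A : C) : ℤ :=
  ∑ᶠ l : ℤ, (l.negOnePow : ℤ) * (Module.finrank k (E ⟶ A⟦l⟧) : ℤ)

/-- The objects with finite-dimensional total space of morphisms from `E`. -/
def HasFiniteHomFrom (E : C) : ObjectProperty C := fun A =>
  (∀ l : ℤ, Module.Finite k (E ⟶ A⟦l⟧)) ∧ {l : ℤ | ¬ Subsingleton (E ⟶ A⟦l⟧)}.Finite

/-- The connecting map of the long exact sequence of morphisms from `E` to a triangle. -/
noncomputable def homConnecting (E : C) (S : Triangle C) (l : ℤ) :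
    (E ⟶ S.obj₃⟦l⟧) →ₗ[k] (E ⟶ S.obj₁⟦l + 1⟧) :=
  Linear.rightComp k E (S.mor₃⟦l⟧' ≫ (shiftFunctorAdd' C 1 l (l + 1) (by ring)).inv.app _)

variable {k}

/-! ### The long exact sequence of morphisms from a fixed object -/

section Exact

variable (E : C) (S : Triangle C) (hS : S ∈ distTriang C) (l : ℤ)
include hS

lemma hom_exact₂ : Function.Exact (Linear.rightComp k E (S.mor₁⟦l⟧'))
    (Linear.rightComp k E (S.mor₂⟦l⟧')) := fun x =>
  (ShortComplex.ab_exact_iff_function_exact _).1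
    ((preadditiveCoyoneda.obj (Opposite.op E)).homologySequence_exact₂ S hS l) x

/-- The connecting map of the homological functor `Hom(E, -)` is `homConnecting`, so exactness
carries over. -/
lemma hom_exact₃ : Function.Exact (Linear.rightComp k E (S.mor₂⟦l⟧'))
    (homConnecting k E S l) := fun x => by
  have := (ShortComplex.ab_exact_iff_function_exact _).1
    ((preadditiveCoyoneda.obj (Opposite.op E)).homologySequence_exact₃ S hS l (l + 1) rfl) x
  have h := preadditiveCoyoneda_homologySequenceδ_apply S l (l + 1) rfl (A := Opposite.op E) x
  exact ⟨fun hx => this.1 (h.trans hx), fun hx => h.symm.trans (this.2 hx)⟩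

lemma hom_exact₁ : Function.Exact (homConnecting k E S l)
    (Linear.rightComp k E (S.mor₁⟦l + 1⟧')) := fun x => by
  have := (ShortComplex.ab_exact_iff_function_exact _).1
    ((preadditiveCoyoneda.obj (Opposite.op E)).homologySequence_exact₁ S hS l (l + 1) rfl) x
  have h := preadditiveCoyoneda_homologySequenceδ_apply S l (l + 1) rfl (A := Opposite.op E)
  refine ⟨fun hx => ?_, ?_⟩
  · obtain ⟨y, hy⟩ := this.1 hx
    exact ⟨y, (h y).symm.trans hy⟩
  · rintro ⟨y, hy⟩
    exact this.2 ⟨y, (h y).trans hy⟩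

end Exact

lemma eulerPairing_eq_add (E : C) (S : Triangle C) (hS : S ∈ distTriang C)
    (h₁ : HasFiniteHomFrom k E S.obj₁) (h₂ : HasFiniteHomFrom k E S.obj₂)
    (h₃ : HasFiniteHomFrom k E S.obj₃) :
    eulerPairing k E S.obj₂ = eulerPairing k E S.obj₁ + eulerPairing k E S.obj₃ := by
  have := h₁.1
  have := h₂.1
  have := h₃.1
  exact finsum_negOnePow_finrank_of_exact _ _ _ (hom_exact₂ E S hS) (hom_exact₃ E S hS)
    (hom_exact₁ E S hS) h₁.2 h₃.2

/-- A linear equivalence on morphisms induced by an isomorphism. -/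
def homLinearEquivOfIso (E : C) {A B : C} (e : A ≅ B) : (E ⟶ A) ≃ₗ[k] (E ⟶ B) :=
  LinearEquiv.ofLinearMap (Linear.rightComp k E e.hom) (Linear.rightComp k E e.inv)
    (by ext; simp) (by ext; simp)

instance (E : C) : (HasFiniteHomFrom k E).IsClosedUnderIsomorphisms where
  of_iso {A B} e h := by
    have e' (l : ℤ) : (E ⟶ A⟦l⟧) ≃ₗ[k] (E ⟶ B⟦l⟧) :=
      homLinearEquivOfIso E ((shiftFunctor C l).mapIso e)
    refine ⟨fun l => ?_, h.2.subset fun l hl h' => hl (e' l).symm.toEquiv.subsingleton⟩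
    have := h.1 l
    exact Module.Finite.equiv (e' l)

/-- This lets fullness spread finiteness from the members of a collection to every object, so that
no finiteness of morphism spaces in the ambient category has to be known. -/
instance (E : C) : (HasFiniteHomFrom k E).IsTriangulated where
  exists_zero := by
    refine ⟨0, isZero_zero C, fun l => ?_, ?_⟩
    · have : Subsingleton (E ⟶ (0 : C)⟦l⟧) :=
        ⟨((shiftFunctor C l).map_isZero (isZero_zero C)).eq_of_tgt⟩
      infer_instance
    · convert Set.finite_empty (α := ℤ)
      ext l
      simpa using ⟨((shiftFunctor C l).map_isZero (isZero_zero C)).eq_of_tgt⟩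
  isStableUnderShiftBy a :=
    { le_shift := fun A h => by
        have e (l : ℤ) : (E ⟶ A⟦a + l⟧) ≃ₗ[k] (E ⟶ A⟦a⟧⟦l⟧) :=
          homLinearEquivOfIso E ((shiftFunctorAdd C a l).app A)
        refine ⟨fun l => ?_, ?_⟩
        · have := h.1 (a + l)
          exact Module.Finite.equiv (e l)
        · refine (h.2.preimage (f := fun l => a + l) (add_right_injective a).injOn).subset ?_
          exact fun l hl h' => hl (e l).symm.toEquiv.subsingleton }
  toIsTriangulatedClosed₂ := .mk' fun S hS h₁ h₃ => by
    refine ⟨fun l => ?_, (h₁.2.union h₃.2).subset fun l hl => ?_⟩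
    · have := h₁.1 l
      have := h₃.1 l
      exact Module.Finite.of_exact_of_finite _ _ (hom_exact₂ (k := k) E S hS l)
    · by_contra h
      simp only [Set.mem_union, Set.mem_ofPred_eq, not_or, not_not] at h
      obtain ⟨h, h'⟩ := h
      refine hl ⟨fun x y => sub_eq_zero.1 ?_⟩
      obtain ⟨z, hz⟩ := (hom_exact₂ (k := k) E S hS l (x - y)).1 (Subsingleton.elim _ _)
      rw [← hz, Subsingleton.elim z 0, map_zero]

lemma eulerPairing_eq_zero {E A : C} (h : ∀ (l : ℤ) (f : E ⟶ A⟦l⟧), f = 0) :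
    eulerPairing k E A = 0 := by
  have (l : ℤ) : Subsingleton (E ⟶ A⟦l⟧) := ⟨fun f g => (h l f).trans (h l g).symm⟩
  simp [eulerPairing, Module.finrank_zero_of_subsingleton]

lemma hasFiniteHomFrom_of_eq_zero {E A : C} (h : ∀ (l : ℤ) (f : E ⟶ A⟦l⟧), f = 0) :
    HasFiniteHomFrom k E A := by
  have (l : ℤ) : Subsingleton (E ⟶ A⟦l⟧) := ⟨fun f g => (h l f).trans (h l g).symm⟩
  exact ⟨fun l => inferInstance, by simp [this]⟩

/-! ### The coefficient at the last exceptional object -/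

section Exceptional

variable {n : ℕ} {E : Fin (n + 1) → C} (hE : IsExceptionalCollection k E)
include hE

lemma IsExceptionalCollection.finrank_end (i : Fin (n + 1)) :
    Module.finrank k (E i ⟶ E i) = 1 := by
  refine finrank_eq_one (𝟙 (E i)) (fun h => ?_) fun f => ?_
  -- If the identity vanished, the zero endomorphism would be both `0 • 𝟙` and `1 • 𝟙`, against
  -- uniqueness of the scalar.
  · obtain ⟨c, -, hc⟩ := hE.end_eq i 0
    have h₀ := hc 0 (by simp)
    have h₁ := hc 1 (by simp [h])
    exact zero_ne_one (h₀.trans h₁.symm)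
  · obtain ⟨c, hc, -⟩ := hE.end_eq i f
    exact ⟨c, hc.symm⟩

lemma IsExceptionalCollection.finrank_shift_zero (i : Fin (n + 1)) :
    Module.finrank k (E i ⟶ (E i)⟦(0 : ℤ)⟧) = 1 :=
  (homLinearEquivOfIso (E i) ((shiftFunctorZero C ℤ).app (E i))).finrank_eq.trans
    (hE.finrank_end i)

lemma IsExceptionalCollection.subsingleton_shift (i : Fin (n + 1)) {l : ℤ} (hl : l ≠ 0) :
    Subsingleton (E i ⟶ (E i)⟦l⟧) :=
  ⟨fun f g => (hE.shift_eq_zero i l hl f).trans (hE.shift_eq_zero i l hl g).symm⟩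

lemma IsExceptionalCollection.eulerPairing_self (i : Fin (n + 1)) :
    eulerPairing k (E i) (E i) = 1 := by
  rw [eulerPairing, finsum_eq_single _ 0, hE.finrank_shift_zero i]
  · simp
  · intro l hl
    have := hE.subsingleton_shift i hl
    simp [Module.finrank_zero_of_subsingleton]

lemma IsExceptionalCollection.hasFiniteHomFrom_self (i : Fin (n + 1)) :
    HasFiniteHomFrom k (E i) (E i) := by
  refine ⟨fun l => ?_, (Set.finite_singleton 0).subset fun l hl => ?_⟩
  · rcases eq_or_ne l 0 with rfl | hl
    · exact Module.finite_of_finrank_pos (by simp [hE.finrank_shift_zero i])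
    · have := hE.subsingleton_shift i hl
      infer_instance
  · by_contra h
    exact hl (hE.subsingleton_shift i h)

/-- The last member is special: its morphisms to all the other members vanish in every degree, so
only its own endomorphisms matter on generators. -/
lemma IsExceptionalCollection.hasFiniteHomFrom_last (hfull : IsFullCollection E) (A : C) :
    HasFiniteHomFrom k (E (Fin.last n)) A := by
  refine hfull (HasFiniteHomFrom k (E (Fin.last n))) inferInstance inferInstance (fun i => ?_) A
  rcases eq_or_ne i (Fin.last n) with rfl | hi
  · exact hE.hasFiniteHomFrom_self _
  · exact hasFiniteHomFrom_of_eq_zero (hE.semiorthogonal i _ (Fin.lt_last_iff_ne_last.2 hi))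

/-- The coefficient of the last object of a full exceptional collection is a well defined
homomorphism on the Grothendieck group. -/
lemma IsExceptionalCollection.exists_lastCoefficient (hfull : IsFullCollection E)
    (ν : Fin (n + 1) → ℕ) (hν : ν (Fin.last n) = 0) :
    ∃ χ : K0 C →+ ℤ, χ (K0.mk (shiftedCollection E ν (Fin.last n))) = 1 ∧
      ∀ i, i ≠ Fin.last n → χ (K0.mk (shiftedCollection E ν i)) = 0 := by
  -- By semiorthogonality, the Euler pairing with the last object is one on that object and zero on
  -- all the others.
  refine ⟨K0.lift (eulerPairing k (E (Fin.last n))) fun S hS =>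
    eulerPairing_eq_add _ S hS (hE.hasFiniteHomFrom_last hfull _)
      (hE.hasFiniteHomFrom_last hfull _) (hE.hasFiniteHomFrom_last hfull _), ?_, fun i hi => ?_⟩
  · have e : shiftedCollection E ν (Fin.last n) ≅ E (Fin.last n) :=
      (shiftFunctorZero' C _ (by simp [hν])).app _
    rw [K0.mk_eq_of_iso e, K0.lift_mk, hE.eulerPairing_self]
  · rw [K0.lift_mk]
    refine eulerPairing_eq_zero fun l f => ?_
    have h := hE.semiorthogonal i _ (Fin.lt_last_iff_ne_last.2 hi) _
      (f ≫ (shiftFunctorAdd C (ν i : ℤ) l).inv.app (E i))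
    exact (cancel_mono ((shiftFunctorAdd C (ν i : ℤ) l).inv.app (E i))).1 (h.trans zero_comp.symm)

end Exceptional

end Triangulated

/-! ## Semiorthogonal decompositions and distinguished triangles -/

section Semiorthogonal

universe v u

variable {C : Type u} [Category.{v} C] [Preadditive C] [HasZeroObject C] [HasShift C ℤ]
  [∀ n : ℤ, (shiftFunctor C n).Additive] [Pretriangulated C]

/-- A distinguished triangle can be modified along an isomorphism of its third object. -/
lemma distinguished_of_iso₃ {A B D D' : C} {f : A ⟶ B} {g : B ⟶ D} {h : D ⟶ A⟦(1 : ℤ)⟧}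
    (hT : Triangle.mk f g h ∈ distTriang C) (e : D ≅ D') :
    Triangle.mk f (g ≫ e.hom) (e.inv ≫ h) ∈ distTriang C :=
  isomorphic_distinguished _ hT _ (Triangle.isoMk _ _ (Iso.refl _) (Iso.refl _) e.symm
    (by change f ≫ 𝟙 B = 𝟙 A ≫ f; simp)
    (by change (g ≫ e.hom) ≫ e.inv = 𝟙 B ≫ g; simp)
    (by change (e.inv ≫ h) ≫ (𝟙 A)⟦(1 : ℤ)⟧' = e.inv ≫ h; simp))

variable {T N : ObjectProperty C}

/-- The difference of the two maps factors through `B⟦-1⟧`, which lies in `T` and receives no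
nonzero map from `N`. -/
lemma eq_of_comp_eq_of_orthogonal [T.IsTriangulated]
    (hom : ∀ A B, N A → T B → ∀ f : A ⟶ B, f = 0) {A F B : C} {f : A ⟶ F} {g : F ⟶ B}
    {h : B ⟶ A⟦(1 : ℤ)⟧} (hF : Triangle.mk f g h ∈ distTriang C) (hB : T B)
    {A' : C} (hA' : N A') {x y : A' ⟶ A} (hxy : x ≫ f = y ≫ f) : x = y := by
  obtain ⟨z, hz⟩ := Triangle.coyoneda_exact₂ _ (inv_rot_of_distTriang _ hF) (x - y)
    (show (x - y) ≫ f = 0 by rw [Preadditive.sub_comp, hxy, sub_self])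
  rw [hom _ _ hA' (T.le_shift (-1 : ℤ) _ hB) z] at hz
  exact sub_eq_zero.1 (hz.trans zero_comp)

/-- Dually, the difference factors through `A⟦1⟧`, which lies in `N`. -/
lemma eq_of_eq_comp_of_orthogonal [N.IsTriangulated]
    (hom : ∀ A B, N A → T B → ∀ f : A ⟶ B, f = 0) {A F B : C} {f : A ⟶ F} {g : F ⟶ B}
    {h : B ⟶ A⟦(1 : ℤ)⟧} (hF : Triangle.mk f g h ∈ distTriang C) (hA : N A)
    {B' : C} (hB' : T B') {x y : B ⟶ B'} (hxy : g ≫ x = g ≫ y) : x = y := by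
  obtain ⟨z, hz⟩ := Triangle.yoneda_exact₃ _ hF (x - y)
    (show g ≫ (x - y) = 0 by rw [Preadditive.comp_sub, hxy, sub_self])
  rw [hom _ _ (N.le_shift (1 : ℤ) _ hA) hB' z] at hz
  exact sub_eq_zero.1 (hz.trans comp_zero)

/-- The triangle of a semiorthogonal decomposition is unique up to isomorphism. -/
lemma nonempty_iso_of_orthogonal [T.IsTriangulated] [N.IsTriangulated]
    (hom : ∀ A B, N A → T B → ∀ f : A ⟶ B, f = 0)
    {A F B A' B' : C} {f : A ⟶ F} {g : F ⟶ B} {h : B ⟶ A⟦(1 : ℤ)⟧}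
    {f' : A' ⟶ F} {g' : F ⟶ B'} {h' : B' ⟶ A'⟦(1 : ℤ)⟧}
    (hF : Triangle.mk f g h ∈ distTriang C) (hF' : Triangle.mk f' g' h' ∈ distTriang C)
    (hA : N A) (hB : T B) (hA' : N A') (hB' : T B') : Nonempty (A ≅ A') ∧ Nonempty (B ≅ B') := by
  obtain ⟨a, ha⟩ : ∃ a : A ⟶ A', f = a ≫ f' :=
    Triangle.coyoneda_exact₂ _ hF' f (hom _ _ hA hB' _)
  obtain ⟨a', ha'⟩ : ∃ a : A' ⟶ A, f' = a ≫ f :=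
    Triangle.coyoneda_exact₂ _ hF f' (hom _ _ hA' hB _)
  obtain ⟨b, hb⟩ : ∃ b : B ⟶ B', g' = g ≫ b :=
    Triangle.yoneda_exact₂ _ hF g' (hom _ _ hA hB' _)
  obtain ⟨b', hb'⟩ : ∃ b : B' ⟶ B, g = g' ≫ b :=
    Triangle.yoneda_exact₂ _ hF' g (hom _ _ hA' hB _)
  refine ⟨⟨⟨a, a', ?_, ?_⟩⟩, ⟨⟨b, b', ?_, ?_⟩⟩⟩
  · exact eq_of_comp_eq_of_orthogonal hom hF hB hA (by rw [Category.assoc, ← ha', ← ha]; simp)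
  · exact eq_of_comp_eq_of_orthogonal hom hF' hB' hA' (by rw [Category.assoc, ← ha, ← ha']; simp)
  · exact eq_of_eq_comp_of_orthogonal hom hF hA hB (by rw [← Category.assoc, ← hb, ← hb']; simp)
  · exact eq_of_eq_comp_of_orthogonal hom hF' hA' hB' (by
      rw [← Category.assoc, ← hb', ← hb]; simp)

/-- The projections to the components of a semiorthogonal decomposition preserve distinguished
triangles. -/
lemma exists_distinguished_projections [IsTriangulated C] [T.IsTriangulated] [N.IsTriangulated]
    (hom : ∀ A B, N A → T B → ∀ f : A ⟶ B, f = 0)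
    {Y F Q : C} {u : Y ⟶ F} {v : F ⟶ Q} {w : Q ⟶ Y⟦(1 : ℤ)⟧}
    (hYFQ : Triangle.mk u v w ∈ distTriang C)
    {NY NF NQ : N.FullSubcategory} {TY TF TQ : T.FullSubcategory}
    {fY : NY.obj ⟶ Y} {gY : Y ⟶ TY.obj} {hY : TY.obj ⟶ NY.obj⟦(1 : ℤ)⟧}
    (hY' : Triangle.mk fY gY hY ∈ distTriang C)
    {fF : NF.obj ⟶ F} {gF : F ⟶ TF.obj} {hF : TF.obj ⟶ NF.obj⟦(1 : ℤ)⟧}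
    (hF' : Triangle.mk fF gF hF ∈ distTriang C)
    {fQ : NQ.obj ⟶ Q} {gQ : Q ⟶ TQ.obj} {hQ : TQ.obj ⟶ NQ.obj⟦(1 : ℤ)⟧}
    (hQ' : Triangle.mk fQ gQ hQ ∈ distTriang C) :
    (∃ (a : NY ⟶ NF) (b : NF ⟶ NQ) (c : NQ ⟶ NY⟦(1 : ℤ)⟧),
      Triangle.mk a b c ∈ distTriang N.FullSubcategory ∧ a.hom ≫ fF = fY ≫ u) ∧
    (∃ (a : TY ⟶ TF) (b : TF ⟶ TQ) (c : TQ ⟶ TY⟦(1 : ℤ)⟧),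
      Triangle.mk a b c ∈ distTriang T.FullSubcategory ∧ gY ≫ a.hom = u ≫ gF) := by
  obtain ⟨a, ha⟩ : ∃ a : NY.obj ⟶ NF.obj, fY ≫ u = a ≫ fF :=
    Triangle.coyoneda_exact₂ _ hF' (fY ≫ u) (hom _ _ NY.property TF.property _)
  -- The cone `P` of `NY → F` is computed through `Y` and through `NF`, which yields triangles `TY →
  -- P → Q` and `N' → P → TF`. A third octahedron, on `TY → P → TF`, produces `N' → Q → T'` with
  -- `N'` in `N` and `T'` in `T`; by uniqueness this is the decomposition of `Q`.
  obtain ⟨P, p, q, hP⟩ := distinguished_cocone_triangle (fY ≫ u)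
  obtain ⟨N', b, c, hN'⟩ := distinguished_cocone_triangle (ObjectProperty.homMk a : NY ⟶ NF)
  have hN'' := N.ι.map_distinguished _ hN'
  let O₁ := someOctahedron rfl hY' hYFQ hP
  let O₂ := someOctahedron ha.symm hN'' hF' hP
  obtain ⟨T', b', c', hT'⟩ := distinguished_cocone_triangle
    (ObjectProperty.homMk (O₁.m₁ ≫ O₂.m₃) : TY ⟶ TF)
  have hT'' := T.ι.map_distinguished _ hT'
  let O₃ := someOctahedron rfl O₁.mem (rot_of_distTriang _ O₂.mem) hT''
  have hQ'' := inv_rot_of_distTriang _ O₃.mem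
  have hN₁ : N (N'.obj⟦(1 : ℤ)⟧⟦(-1 : ℤ)⟧) := N.le_shift _ _ (N.le_shift _ _ N'.property)
  obtain ⟨⟨e⟩, ⟨e'⟩⟩ := nonempty_iso_of_orthogonal hom hQ'' hQ' hN₁ T'.property NQ.property
    TQ.property
  let e₁ : N' ≅ NQ := N.isoMk ((shiftShiftNeg N'.obj (1 : ℤ)).symm ≪≫ e)
  let e₂ : T' ≅ TQ := T.isoMk e'
  refine ⟨⟨_, _, _, distinguished_of_iso₃ hN' e₁, ha.symm⟩,
    ⟨_, _, _, distinguished_of_iso₃ hT' e₂, ?_⟩⟩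
  have h₁ := O₁.comm₁
  have h₃ := O₂.comm₃
  change gY ≫ O₁.m₁ ≫ O₂.m₃ = u ≫ gF
  rw [← Category.assoc, h₁, Category.assoc, h₃]

/-- A monomorphism of a heart which vanishes has a zero source. -/
lemma CategoryTheory.Triangulated.TStructure.isZero_of_heart_of_mor₁_eq_zero (t : TStructure C)
    {S : Triangle C} (hS : S ∈ distTriang C) (h₁ : t.heart S.obj₁) (h₃ : t.heart S.obj₃)
    (h : S.mor₁ = 0) : IsZero S.obj₁ := by
  rw [t.mem_heart_iff] at h₁ h₃
  have := h₁.1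
  have := h₃.2
  have : t.IsLE (S.obj₁⟦(1 : ℤ)⟧) (-1) := t.isLE_shift _ 0 1 (-1)
  -- As the first morphism vanishes, the identity of `S.obj₁⟦1⟧` factors through `S.obj₃`; there is
  -- no nonzero map from degrees `≤ -1` to degrees `≥ 0`.
  obtain ⟨z, hz⟩ := Triangle.coyoneda_exact₁ _ hS (𝟙 _) (by simp [h])
  rw [t.zero z (-1) 0, zero_comp] at hz
  have h0 : IsZero (S.obj₁⟦(1 : ℤ)⟧) := (IsZero.iff_id_eq_zero _).2 hz
  exact IsZero.of_iso ((shiftFunctor C (-1 : ℤ)).map_isZero h0) (shiftShiftNeg S.obj₁ (1 : ℤ)).symm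

end Semiorthogonal

/-! ## Comparison of phases in the upper half plane -/

/-- The cross product is `‖z‖ ‖w‖ sin (arg w - arg z)`, and the difference of the arguments lies in
`(-π, π)`, where the sine has the sign of its argument. -/
lemma Complex.arg_lt_arg_iff_of_im_pos {z w : ℂ} (hz : 0 < z.im) (hw : 0 < w.im) :
    z.arg < w.arg ↔ w.re * z.im < z.re * w.im := by
  have hz₀ : 0 ≤ z.arg := Complex.arg_nonneg_iff.2 hz.le
  have hw₀ : 0 ≤ w.arg := Complex.arg_nonneg_iff.2 hw.le
  have hz' : z.arg < Real.pi := Complex.arg_lt_pi_iff.2 (Or.inr hz.ne')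
  have hw' : w.arg < Real.pi := Complex.arg_lt_pi_iff.2 (Or.inr hw.ne')
  have hzn : 0 < ‖z‖ := norm_pos_iff.2 fun h => by simp [h] at hz
  have hwn : 0 < ‖w‖ := norm_pos_iff.2 fun h => by simp [h] at hw
  have key : ‖z‖ * ‖w‖ * Real.sin (w.arg - z.arg) = z.re * w.im - w.re * z.im := by
    linear_combination ‖z‖ * ‖w‖ * Real.sin_sub w.arg z.arg +
      ‖w‖ * Real.sin w.arg * Complex.norm_mul_cos_arg z +
      z.re * Complex.norm_mul_sin_arg w - ‖w‖ * Real.cos w.arg * Complex.norm_mul_sin_arg z -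
      z.im * Complex.norm_mul_cos_arg w
  have hpos : 0 < ‖z‖ * ‖w‖ := mul_pos hzn hwn
  constructor
  · intro h
    have := mul_pos hpos (Real.sin_pos_of_pos_of_lt_pi (sub_pos.2 h) (by linarith))
    linarith
  · intro h
    by_contra! h'
    have := mul_nonpos_of_nonneg_of_nonpos hpos.le
      (Real.sin_nonpos_of_nonpos_of_neg_pi_le (sub_nonpos.2 h') (by linarith))
    linarith

/-! ## Extension closures of finite families -/

section ExtensionClosure

universe v u

variable {C : Type u} [Category.{v} C] [Preadditive C] [HasZeroObject C] [HasShift C ℤ]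
  [∀ n : ℤ, (shiftFunctor C n).Additive] [Pretriangulated C]

/-- Vanishing of `Hom(-, D)` passes to middle terms of triangles. This is how efficiency, a
condition on the generators, reaches subobjects. -/
lemma ExtensionClosure.hom_eq_zero {P : ObjectProperty C} {D : C}
    (hD : ∀ B, P B → ∀ f : B ⟶ D, f = 0) {A : C} (hA : ExtensionClosure P A) (f : A ⟶ D) :
    f = 0 := by
  induction hA with
  | of A hA => exact hD A hA f
  | zero A hA => exact hA.eq_of_src _ _
  | ext S hS _ _ h₁ h₃ =>
    obtain ⟨g, rfl⟩ := Triangle.yoneda_exact₂ S hS f (h₁ _)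
    rw [h₃ g, comp_zero]

/-- The class of an object in the extension closure of a family is a nonnegative combination of
those of the family, and the members with zero coefficient can be omitted. -/
lemma ExtensionClosure.exists_coefficients {n : ℕ} {S : Fin (n + 1) → C} {A : C}
    (hA : ExtensionClosure (fun B => ∃ i, B = S i) A) :
    ∃ m : Fin (n + 1) → ℕ, K0.mk A = ∑ i, m i • K0.mk (S i) ∧
      (m (Fin.last n) = 0 → ExtensionClosure (fun B => ∃ i, i ≠ Fin.last n ∧ B = S i) A) := by
  induction hA with
  | of A hA =>
    obtain ⟨i, rfl⟩ := hA
    refine ⟨Pi.single i 1, ?_, fun h => .of _ ⟨i, ?_, rfl⟩⟩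
    · rw [Finset.sum_eq_single i (fun j _ hj => by simp [hj]) (by simp)]
      simp
    · rintro rfl
      simp at h
  | zero A hA => exact ⟨0, by simp [K0.mk_eq_zero hA], fun _ => .zero A hA⟩
  | ext S hS _ _ h₁ h₃ =>
    obtain ⟨m, hm, hm'⟩ := h₁
    obtain ⟨m', hm₁, hm₁'⟩ := h₃
    refine ⟨m + m', ?_, fun h => ?_⟩
    · simp only [K0.mk_eq_add hS, hm, hm₁, Pi.add_apply, add_smul, Finset.sum_add_distrib]
    · simp only [Pi.add_apply, Nat.add_eq_zero_iff] at h
      exact .ext S hS (hm' h.1) (hm₁' h.2)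

/-! ### Central charges of nonnegative combinations -/

section Charge

variable {n : ℕ} {S : Fin (n + 1) → C} {A : C} {m : Fin (n + 1) → ℕ}
  (hm : K0.mk A = ∑ i, m i • K0.mk (S i)) (W : K0 C →+ ℂ)
include hm

lemma re_charge_eq_sum : (W (K0.mk A)).re = ∑ i, m i * (W (K0.mk (S i))).re := by
  simp [hm, map_sum, map_nsmul, Complex.re_sum]

lemma im_charge_eq_sum : (W (K0.mk A)).im = ∑ i, m i * (W (K0.mk (S i))).im := by
  simp [hm, map_sum, map_nsmul, Complex.im_sum]

lemma re_last_le_re_charge (h : ∀ i, 0 < (W (K0.mk (S i))).re) (h₁ : m (Fin.last n) = 1) :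
    (W (K0.mk (S (Fin.last n)))).re ≤ (W (K0.mk A)).re := by
  rw [re_charge_eq_sum hm]
  have := Finset.single_le_sum (f := fun i => (m i : ℝ) * (W (K0.mk (S i))).re)
    (fun i _ => mul_nonneg (Nat.cast_nonneg _) (h i).le) (Finset.mem_univ (Fin.last n))
  simpa [h₁] using this

lemma im_charge_pos (h : ∀ i, 0 < (W (K0.mk (S i))).im) (h₁ : m (Fin.last n) = 1) :
    0 < (W (K0.mk A)).im := by
  rw [im_charge_eq_sum hm]
  have := Finset.single_le_sum (f := fun i => (m i : ℝ) * (W (K0.mk (S i))).im)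
    (fun i _ => mul_nonneg (Nat.cast_nonneg _) (h i).le) (Finset.mem_univ (Fin.last n))
  have h' := h (Fin.last n)
  simp only [h₁, Nat.cast_one, one_mul] at this
  linarith

lemma im_charge_nonneg (h : ∀ i, 0 < (W (K0.mk (S i))).im) : 0 ≤ (W (K0.mk A)).im := by
  rw [im_charge_eq_sum hm]
  exact Finset.sum_nonneg fun i _ => mul_nonneg (Nat.cast_nonneg _) (h i).le

/-- An object whose class does not involve the last member of the family has at least the phase of
any object that has smaller phase than the other members. -/
lemma re_mul_im_le_of_phase_lt (h : ∀ i, 0 < (W (K0.mk (S i))).im)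
    (h₀ : m (Fin.last n) = 0) {B : C} (hB : 0 < (W (K0.mk B)).im)
    (hphase : ∀ i, i ≠ Fin.last n → phase W B < phase W (S i)) :
    (W (K0.mk A)).re * (W (K0.mk B)).im ≤ (W (K0.mk B)).re * (W (K0.mk A)).im := by
  rw [re_charge_eq_sum hm, im_charge_eq_sum hm, Finset.sum_mul, Finset.mul_sum]
  refine Finset.sum_le_sum fun i _ => ?_
  rcases eq_or_ne i (Fin.last n) with rfl | hi
  · simp [h₀]
  · have := (Complex.arg_lt_arg_iff_of_im_pos hB (h i)).1
      ((div_lt_div_iff_of_pos_right Real.pi_pos).1 (hphase i hi))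
    have := mul_le_mul_of_nonneg_left this.le (Nat.cast_nonneg (α := ℝ) (m i))
    linarith

/-- Makes the spike condition applicable to an actual object; its nonzero charge guarantees that the
vector in the cone is nonzero. -/
lemma exists_openCone (h₀ : m (Fin.last n) = 0) (hA : W (K0.mk A) ≠ 0) :
    ∃ w ∈ openCone S, chargeReal W w = W (K0.mk A) := by
  have key : chargeReal W (∑ i : Fin n, (m i.castSucc : ℝ) •
      ((1 : ℝ) ⊗ₜ[ℤ] K0.mk (S i.castSucc))) = W (K0.mk A) := by
    simp [hm, map_sum, map_nsmul, Fin.sum_univ_castSucc, h₀, chargeReal_tmul]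
  refine ⟨_, ⟨fun h => hA ?_, fun i => m i.castSucc, fun i => Nat.cast_nonneg _, rfl⟩, key⟩
  rw [← key, h, map_zero]

/-- This is the spike condition multiplied by the positive imaginary part of the charge of `A`,
which clears the denominator. -/
lemma IsSpiked.re_mul_im_lt {u : K0 C} (hW : IsSpiked W S u) (h₀ : m (Fin.last n) = 0)
    (hA : 0 < (W (K0.mk A)).im) :
    (W (K0.mk A)).re * (W u).im < ((W (K0.mk (S (Fin.last n)))).re - 1) * (W (K0.mk A)).im := by
  obtain ⟨w, hw, hw'⟩ := exists_openCone hm W h₀ (fun h => by simp [h] at hA)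
  have := hW.spike w hw
  rw [hw'] at this
  have := mul_pos this hA
  have e : (W (K0.mk A)).re / (W (K0.mk A)).im * (W u).im * (W (K0.mk A)).im =
    (W (K0.mk A)).re * (W u).im := by
    field_simp
  linarith

end Charge

/-! ### Norm functions and the phases of blocks -/

section Blocks

variable {n : ℕ} {r : Fin (n + 1) → Fin (n + 1) → Prop} {k : ℕ} {ν : Fin (n + 1) → ℕ}
  (hν : IsNormFunction r k ν)
include hν

/-- Elements of norm zero are maximal, and sharpness allows only one of them. -/
lemma IsNormFunction.eq_zero_iff (hsharp : IsSharp r) (hlt : ∀ i j, i < j → r i j)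
    (i : Fin (n + 1)) : ν i = 0 ↔ i = Fin.last n := by
  have h₀ : ν (Fin.last n) = 0 := by
    -- Norm zero is attained somewhere, and the last index lies above every other one, so its norm
    -- is zero as well.
    obtain ⟨j, hj⟩ : 0 ∈ Set.range ν := by
      rw [hν.1]
      exact Nat.zero_le k
    rcases (Fin.le_last j).lt_or_eq with h | rfl
    · have := (hν.2 _ _).1 (hlt _ _ h)
      omega
    · exact hj
  refine ⟨fun hi => ?_, fun hi => hi ▸ h₀⟩
  have hmax (j) (hj : ν j = 0) : ∀ l, r j l → r l j := fun l _ =>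
    (hν.2 l j).2 (by rw [hj]; exact Nat.zero_le _)
  exact hsharp.unique (hmax i hi) (hmax _ h₀)

omit hν in
lemma minBlockPhase_le (W : K0 C →+ ℂ) (S : Fin (n + 1) → C) (i : Fin (n + 1)) :
    minBlockPhase W S ν (ν i) ≤ phase W (S i) :=
  ciInf_le (f := fun j : {j // ν j = ν i} => phase W (S j)) (Set.finite_range _).bddBelow ⟨i, rfl⟩

/-- The chain of inequalities between the phases of the blocks bounds all phases from below. -/
lemma IsNormFunction.lt_phase (W : K0 C →+ ℂ) (S : Fin (n + 1) → C) (φ : ℝ)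
    (h₂ : 1 ≤ k → φ < minBlockPhase W S ν 1)
    (h₃ : ∀ j, 1 ≤ j → j ≤ k → minBlockPhase W S ν j ≤ maxBlockPhase W S ν j)
    (h₄ : ∀ j, 1 ≤ j → j < k → maxBlockPhase W S ν j < minBlockPhase W S ν (j + 1))
    (i : Fin (n + 1)) (hi : ν i ≠ 0) : φ < phase W (S i) := by
  have hk : ν i ≤ k := by
    have : ν i ∈ Set.range ν := ⟨i, rfl⟩
    rwa [hν.1] at this
  have key (j : ℕ) (hj : 1 ≤ j) : j ≤ k → φ < minBlockPhase W S ν j := by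
    induction j, hj using Nat.le_induction with
    | base => exact h₂
    | succ j hj ih =>
      intro hjk
      exact ((ih (by omega)).trans_le (h₃ j hj (by omega))).trans (h₄ j hj hjk)
  exact (key _ (Nat.one_le_iff_ne_zero.2 hi) hk).trans_le (minBlockPhase_le W S i)

end Blocks

/-- A stable object of phase one is simple in the heart. -/
lemma StabilityCondition.IsStable.isZero_or_isZero {Λ : Type*} [AddCommGroup Λ] {v : K0 C →+ Λ}
    {σ : StabilityCondition v} {S : Triangle C} (hS : S ∈ distTriang C)
    (hstable : σ.IsStable S.obj₂) (hphase : σ.phase S.obj₂ = 1) (h₁ : σ.heart S.obj₁)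
    (h₃ : σ.heart S.obj₃) : IsZero S.obj₁ ∨ IsZero S.obj₃ := by
  by_contra! h
  have hlt := hstable.2.2 S.mor₁ S.mor₂ S.mor₃ hS h₁ h₃ h.1 h.2
  have e := congrArg σ.charge (K0.mk_eq_add hS)
  rw [map_add] at e
  have harg : (σ.charge (K0.mk S.obj₂)).arg = Real.pi := by
    have := hphase
    rwa [StabilityCondition.phase, _root_.phase, div_eq_one_iff_eq Real.pi_ne_zero] at this
  -- The imaginary parts of the outer terms are nonnegative with sum zero, so both vanish. The
  -- subobject then also has phase one, against strict inequality.
  have him := (Complex.arg_eq_pi_iff.1 harg).2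
  rw [e, Complex.add_im] at him
  have hm₁ := σ.charge_mem _ h₁ h.1
  have hm₃ := σ.charge_mem _ h₃ h.2
  have hm₁' : (σ.charge (K0.mk S.obj₁)).im = 0 ∧ (σ.charge (K0.mk S.obj₁)).re < 0 := by
    rcases hm₁ with h' | h'
    · rcases hm₃ with h'' | h'' <;> linarith
    · exact h'
  have : _root_.phase σ.charge S.obj₁ = _root_.phase σ.charge S.obj₂ := by
    rw [_root_.phase, _root_.phase, harg, Complex.arg_eq_pi_iff.2 hm₁'.symm]
  exact hlt.ne this

end ExtensionClosure

/-! ## Stability of glued objects -/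

section Gluing

universe v u

variable {C : Type u} [Category.{v} C] [Preadditive C] [HasZeroObject C] [HasShift C ℤ]
  [∀ n : ℤ, (shiftFunctor C n).Additive] [Pretriangulated C] [IsTriangulated C]
  {k : Type*} [Field k] [Linear k C]
  {T N : ObjectProperty C} [T.IsTriangulated] [N.IsTriangulated]

/-- Let `F` be an object of a glued heart whose projection `TF` to `T` is stable of phase one and
whose projection `NF` to `N` is efficient with coefficient one at the last member of a full
exceptional collection. If the central charge on `N` is spiked with respect to `NF`, and all
members but the last have larger phase than `NF`, then `F` is stable or splits. -/
theorem IsGlued.isStable_or_nonempty_iso {Λ ΛT ΛN : Type*} [AddCommGroup Λ] [AddCommGroup ΛT]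
    [AddCommGroup ΛN] {v : K0 C →+ Λ} {vT : K0 T.FullSubcategory →+ ΛT}
    {vN : K0 N.FullSubcategory →+ ΛN} {σ : StabilityCondition v} {τ : StabilityCondition vT}
    {η : StabilityCondition vN} (hσ : IsGlued σ τ η)
    (hTN : IsSemiorthogonalDecomposition T N)
    {n : ℕ} {E : Fin (n + 1) → N.FullSubcategory} (hE : IsExceptionalCollection k E)
    (hEfull : IsFullCollection E) {ν : Fin (n + 1) → ℕ} (hν : ∀ i, ν i = 0 ↔ i = Fin.last n)
    (hη : ∀ A, η.heart A ↔ ExtensionClosure (fun B => ∃ i, B = shiftedCollection E ν i) A)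
    {F : C} {NF : N.FullSubcategory} {TF : T.FullSubcategory}
    {a : NF.obj ⟶ F} {b : F ⟶ TF.obj} {c : TF.obj ⟶ NF.obj⟦(1 : ℤ)⟧}
    (hF : Triangle.mk a b c ∈ distTriang C)
    (hspiked : IsSpiked η.charge (shiftedCollection E ν) (K0.mk NF))
    (hcharge : τ.charge (K0.mk TF) = -1) (hFheart : σ.heart F)
    (hpr : LastCoefficientEq (shiftedCollection E ν) NF 1) (hefficient : IsEfficient E ν NF)
    (hstable : τ.IsStable TF) (hphase : τ.phase TF = 1)
    (hlt : ∀ i, i ≠ Fin.last n →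
      phase η.charge NF < phase η.charge (shiftedCollection E ν i)) :
    σ.IsStable F ∨ Nonempty (F ≅ NF.obj ⊞ TF.obj) := by
  by_cases hsplit : Nonempty (F ≅ NF.obj ⊞ TF.obj)
  · exact Or.inr hsplit
  refine Or.inl ?_
  -- With `χ`, the integral expansion given for `NF` and the nonnegative expansions of objects of
  -- the heart have the same last coefficient.
  obtain ⟨χ, hχ₁, hχ₀⟩ := hE.exists_lastCoefficient hEfull ν ((hν _).2 rfl)
  have hχ {A : N.FullSubcategory} {m : Fin (n + 1) → ℕ}
      (hm : K0.mk A = ∑ i, m i • K0.mk (shiftedCollection E ν i)) :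
      χ (K0.mk A) = m (Fin.last n) := by
    rw [hm, map_sum, Finset.sum_eq_single (Fin.last n)]
    · simp [hχ₁]
    · intro i _ hi
      simp [hχ₀ i hi]
    · simp
  have hχNF : χ (K0.mk NF) = 1 := by
    obtain ⟨m, hm, hm₁⟩ := hpr
    rw [hm, map_sum, Finset.sum_eq_single (Fin.last n)]
    · simp [hχ₁, hm₁]
    · intro i _ hi
      simp [hχ₀ i hi]
    · simp
  have hNF : η.heart NF := by
    obtain ⟨A, B, f, g, h, hT, hA, -⟩ := (hσ.heart_iff F).1 hFheart
    obtain ⟨⟨e⟩, -⟩ := nonempty_iso_of_orthogonal hTN.hom_eq_zero hT hF A.property B.property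
      NF.property TF.property
    exact η.tStructure.heart.prop_of_iso (N.isoMk e) hA
  obtain ⟨m, hm, -⟩ := ((hη NF).1 hNF).exists_coefficients
  have hm₁ : m (Fin.last n) = 1 := by
    have := hχ hm
    rw [hχNF] at this
    exact_mod_cast this.symm
  have hre := re_last_le_re_charge hm η.charge hspiked.re_pos hm₁
  have him := im_charge_pos hm η.charge hspiked.im_pos hm₁
  have hcF : σ.charge (K0.mk F) = η.charge (K0.mk NF) - 1 := by
    have := congrArg σ.charge (K0.mk_eq_add hF)
    rw [map_add] at this
    exact this.trans (by
      rw [sub_eq_add_neg, ← hcharge, ← hσ.charge_left, ← hσ.charge_right]; rfl)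
  refine ⟨hFheart, fun h0 => ?_, fun Y Q u v' w hYFQ hY hQ hY0 hQ0 => ?_⟩
  · rw [K0.mk_eq_zero h0, map_zero] at hcF
    have := congrArg Complex.im hcF
    simp at this
    linarith
  obtain ⟨NY, TY, fY, gY, hY', hYT, hNY, hTY⟩ := (hσ.heart_iff Y).1 hY
  obtain ⟨NQ, TQ, fQ, gQ, hQ', hQT, hNQ, hTQ⟩ := (hσ.heart_iff Q).1 hQ
  obtain ⟨⟨a₁, b₁, c₁, hN₁, -⟩, ⟨a₂, b₂, c₂, hT₂, hcomm⟩⟩ :=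
    exists_distinguished_projections hTN.hom_eq_zero hYFQ hYT hF hQT
  have hcY : σ.charge (K0.mk Y) = η.charge (K0.mk NY) + τ.charge (K0.mk TY) := by
    have := congrArg σ.charge (K0.mk_eq_add hYT)
    rw [map_add] at this
    exact this.trans (by rw [← hσ.charge_left, ← hσ.charge_right]; rfl)
  have hKN : K0.mk NF = K0.mk NY + K0.mk NQ := K0.mk_eq_add hN₁
  have hKT : K0.mk TF = K0.mk TY + K0.mk TQ := K0.mk_eq_add hT₂
  obtain ⟨p, hp, hp₀⟩ := ((hη NY).1 hNY).exists_coefficients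
  obtain ⟨q, hq, -⟩ := ((hη NQ).1 hNQ).exists_coefficients
  have hpq : p (Fin.last n) + q (Fin.last n) = 1 := by
    have := congrArg χ hKN
    rw [map_add, hχNF, hχ hp, hχ hq] at this
    exact_mod_cast this.symm
  have hTzero : IsZero TY ∨ IsZero TQ :=
    StabilityCondition.IsStable.isZero_or_isZero hT₂ hstable hphase hTY hTQ
  have hp₁ : p (Fin.last n) = 1 := by
    -- Here `NY` is built without the last object, so efficiency makes `NY → NF` zero. This is the
    -- only case in which splitting can occur.
    by_contra hne
    have hNY0 : IsZero NY := by
      refine η.tStructure.isZero_of_heart_of_mor₁_eq_zero hN₁ hNY hNQ ?_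
      refine (hp₀ (by omega)).hom_eq_zero ?_ _
      rintro _ ⟨i, hi, rfl⟩ f
      exact hefficient i (fun h => hi ((hν i).1 h)) f
    have hNY0' : IsZero NY.obj := N.ι.map_isZero hNY0
    rcases hTzero with h0 | h0
    · exact hY0 (Triangle.isZero₂_of_isZero₁₃ _ hYT hNY0' (T.ι.map_isZero h0))
    · have h₁ : IsIso gY := (Triangle.isZero₁_iff_isIso₂ _ hYT).1 hNY0'
      have h₂ : IsIso a₂ := (Triangle.isZero₃_iff_isIso₁ _ hT₂).1 h0
      have h₂' : IsIso a₂.hom := inferInstanceAs (IsIso (T.ι.map a₂))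
      have h₃ : IsIso (u ≫ b) := hcomm ▸ inferInstance
      -- The composite `Y → F → TF` is now an isomorphism, so `b` has a section and `b ≫ c = 0`
      -- forces `c = 0`.
      have hc : c = 0 := by
        have hbc : b ≫ c = 0 := comp_distTriang_mor_zero₂₃ _ hF
        rw [← cancel_epi (u ≫ b), Category.assoc, hbc, comp_zero, comp_zero]
      exact hsplit ⟨(exists_iso_binaryBiproduct_of_distTriang _ hF hc).choose⟩
  have hq₀ : q (Fin.last n) = 0 := by omega
  have himY := im_charge_pos hp η.charge hspiked.im_pos hp₁
  have himQ := im_charge_nonneg hq η.charge hspiked.im_pos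
  have hcN := congrArg η.charge hKN
  rw [map_add] at hcN
  have hcN_re := congrArg Complex.re hcN
  have hcN_im := congrArg Complex.im hcN
  rw [Complex.add_re] at hcN_re
  rw [Complex.add_im] at hcN_im
  refine div_lt_div_of_pos_right ?_ Real.pi_pos
  rw [hcY, hcF]
  rcases hTzero with h0 | h0
  · have hle := re_mul_im_le_of_phase_lt hq η.charge hspiked.im_pos hq₀ him hlt
    rw [K0.mk_eq_zero h0, map_zero, add_zero, Complex.arg_lt_arg_iff_of_im_pos himY (by simpa)]
    simp only [Complex.sub_re, Complex.sub_im, Complex.one_re, Complex.one_im, sub_zero]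
    rw [hcN_re, hcN_im] at hle ⊢
    linarith
  · have hNQ0 : ¬ IsZero NQ := fun h => hQ0 (Triangle.isZero₂_of_isZero₁₃ _ hQT
      (N.ι.map_isZero h) (T.ι.map_isZero h0))
    -- A nonzero object of the heart with real charge would have negative real part, but the real
    -- parts of all the simple charges are positive.
    have himQ' : 0 < (η.charge (K0.mk NQ)).im := by
      rcases η.charge_mem NQ hNQ hNQ0 with h | h
      · exact h
      · exfalso
        have hnonneg : 0 ≤ (η.charge (K0.mk NQ)).re := by
          rw [re_charge_eq_sum hq]
          exact Finset.sum_nonneg fun i _ =>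
            mul_nonneg (Nat.cast_nonneg _) (hspiked.re_pos i).le
        linarith
    have hspike := hspiked.re_mul_im_lt hq η.charge hq₀ himQ'
    rw [K0.mk_eq_zero h0, add_zero] at hKT
    rw [← hKT, hcharge, Complex.arg_lt_arg_iff_of_im_pos (by simpa) (by simpa)]
    simp only [Complex.sub_re, Complex.sub_im, Complex.add_re, Complex.add_im, Complex.neg_re,
      Complex.neg_im, Complex.one_re, Complex.one_im, sub_zero, neg_zero, add_zero]
    -- The spike is stated with `Re W(S_n)`; as `S_n` occurs once in `NF` and all real parts are
    -- positive, it may be replaced by the larger `Re W(NF)`. The result compares `W(NQ)` with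
    -- `W(NF) - 1 = Z(F)`.
    have := mul_le_mul_of_nonneg_right hre himQ
    rw [hcN_re] at this ⊢
    rw [hcN_im] at hspike ⊢
    linarith

end Gluing

theorem mainTheorem10
    (X : SmoothProjectiveVariety) [HasDerivedCategory.{w} X.Mod]
    -- the decomposition of `D^b(X)` into `T` and `N`
    (T N : ObjectProperty X.Db)
    [T.IsTriangulated] [T.IsClosedUnderIsomorphisms]
    [N.IsTriangulated] [N.IsClosedUnderIsomorphisms]
    (hTN : IsSemiorthogonalDecomposition T N)
    -- the sharp graded full exceptional collection of sheaves on `N`, with its norm function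
    {n : ℕ} (E : Fin (n + 1) → N.FullSubcategory)
    (hE : IsExceptionalCollection ℂ E) (hEfull : IsFullCollection E)
    (hEsheaf : ∀ i, X.IsSheaf (E i).obj)
    (r : Fin (n + 1) → Fin (n + 1) → Prop) (hr : IsGrading E r) (hsharp : IsSharp r)
    (k : ℕ) (ν : Fin (n + 1) → ℕ) (hν : IsNormFunction r k ν)
    -- the lattices
    {ΛT ΛN : Type*} [AddCommGroup ΛT] [AddCommGroup ΛN]
    [Module.Finite ℤ ΛT] [Module.Finite ℤ ΛN]
    (v : K0 X.Db →+ ΛT × ΛN) (vT : K0 T.FullSubcategory →+ ΛT) (vN : K0 N.FullSubcategory →+ ΛN)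
    (hvT : ∀ B : T.FullSubcategory, v (K0.mk B.obj) = (vT (K0.mk B), 0))
    (hvN : ∀ A : N.FullSubcategory, v (K0.mk A.obj) = (0, vN (K0.mk A)))
    (hvTsurj : IsRationalSurjection vT) (hvNsurj : IsRationalSurjection vN)
    -- the stability conditions
    (τ : StabilityCondition vT) (η : StabilityCondition vN) (σ : StabilityCondition v)
    (hη : ∀ A, η.heart A ↔
      ExtensionClosure (fun B => ∃ i, B = shiftedCollection E ν i) A)
    (hσ : IsGlued σ τ η)
    -- the object `F` and its projections
    (F : X.Db) (NF : N.FullSubcategory) (TF : T.FullSubcategory)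
    (a : NF.obj ⟶ F) (b : F ⟶ TF.obj) (c : TF.obj ⟶ NF.obj⟦(1 : ℤ)⟧)
    (hF : Triangle.mk a b c ∈ distTriang X.Db)
    (hspiked : IsSpiked η.charge (shiftedCollection E ν) (K0.mk NF))
    (hcharge : τ.charge (K0.mk TF) = -1)
    (hFheart : σ.heart F)
    -- the class of `F` has coefficient one at `Eₙ`
    (hpr : LastCoefficientEq (shiftedCollection E ν) NF 1)
    (hefficient : IsEfficient E ν NF)
    (hstable : τ.IsStable TF) (hphase : τ.phase TF = 1)
    -- the chain `φ(Eₙ) < φ(N^F) < φ⁻(b₁) ≤ φ⁺(b₁) < ⋯ < φ⁻(b_k) ≤ φ⁺(b_k) < 1`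
    (h₀ : η.phase (E (Fin.last n)) < η.phase NF)
    (h₁ : η.phase NF < 1)
    (h₂ : 1 ≤ k → η.phase NF < minBlockPhase η.charge (shiftedCollection E ν) ν 1)
    (h₃ : ∀ j, 1 ≤ j → j ≤ k → minBlockPhase η.charge (shiftedCollection E ν) ν j ≤
      maxBlockPhase η.charge (shiftedCollection E ν) ν j)
    (h₄ : ∀ j, 1 ≤ j → j < k → maxBlockPhase η.charge (shiftedCollection E ν) ν j <
      minBlockPhase η.charge (shiftedCollection E ν) ν (j + 1))
    (h₅ : 1 ≤ k → maxBlockPhase η.charge (shiftedCollection E ν) ν k < 1) :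
    σ.IsStable F ∨ Nonempty (F ≅ NF.obj ⊞ TF.obj) := by 
  -- Sharpness identifies the block of norm zero with the last object, and the chain of block phases
  -- places every other `S_i` above `NF`.
  exact hσ.isStable_or_nonempty_iso hTN hE hEfull (hν.eq_zero_iff hsharp hr.of_lt) hη hF hspiked
    hcharge hFheart hpr hefficient hstable hphase fun i hi => hν.lt_phase η.charge _ _ h₂ h₃ h₄ i
      fun h => hi ((hν.eq_zero_iff hsharp hr.of_lt i).1 h)
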